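/- Let $A\in\mathbb R^{n\times n}$, $B\in\mathbb R^{n\times m}$, $\bar F\in\mathbb R^{m\times n}$, and let $\mu_1,\dots,\mu_v\in\mathbb R$ with $\sum_j\mu_j^2\neq 0$. Consider the $v$ subsystems $$x_{k+1}^i=Ax_k^i+Bu_k^i,\qquad i=1,\dots,v,\ k\ge 0,$$ with arbitrary initial states $x_0^i\in\mathbb R^n$, put $\bar x_k=\sum_i\mu_ix_k^i$ and $\bar u_k=\sum_i\mu_iu_k^i$, and impose the constraint $\bar u_k=\bar F\bar x_k$ for all $k\ge 0$. Let $$J=\sum_{i=1}^{v}\sum_{k=0}^{\infty}\big[(x_k^i)'Qx_k^i+(u_k^i)'Ru_k^i\big]\in[0,\infty],$$ where $Q\ge 0$ and $R>0$ are symmetric, $Q=C'C$, and $(A,C)$ is observable. The following assertions are equivalent. 1. The system is stabilizable subject to the constraint: there are constant matrices $L_i,\bar L_i\in\mathbb R^{m\times n}$ such that under $u_k^i=L_ix_k^i+\bar L_i\bar x_k$, for all initial states, the constraint holds for all $k$ and $\lim_{k\to\infty}x_k^i=0$ for all $i$. 2. $A+B\bar F$ is stable, i.e. all its complex eigenvalues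 have modulus less than $1$. 3. The coupled algebraic Riccati equations $$P=Q+A'PA-A'PB(R+B'PB)^{-1}B'PA,$$ $$\bar P=(A+B\bar F)'\bar P(A+B\bar F)+\bar F'(R+B'PB)\bar F+A'PB(R+B'PB)^{-1}B'PA+A'PB\bar F+\bar F'B'PA$$ have exactly one solution $(P,\bar P)$ in symmetric matrices with $P+\bar P\ge P>0$. In this case, with the solution $(P,\bar P)$ of 3, $K=-(R+B'PB)^{-1}B'PA$ and $\bar K=\bar F-K$, the controller $$u_k^i=Kx_k^i+\frac{\mu_i}{\sum_{j}\mu_j^2}\bar K\bar x_k$$ satisfies the constraint and stabilizes the system. Moreover, for all initial states it minimizes $J$ among all control sequences that satisfy the constraint, and the minimal cost is $$J^*=\sum_{i=1}^{v}(x_0^i)'Px_0^i+\frac{1}{\sum_{j}\mu_j^2}\,\bar x_0'\bar P\bar x_0 .$$ -/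

import Mathlib

open Matrix Filter Topology
open scoped ENNReal

namespace DistributedLQ

noncomputable section

/-- The weighted "average" `∑ i, μ i • z i` of the vectors `z 1, …, z v`. -/
def average {v d : ℕ} (μ : Fin v → ℝ) (z : Fin v → Fin d → ℝ) : Fin d → ℝ :=
  ∑ i, μ i • z i

/-- `x` is the state sequence produced by the control sequence `u` from the initial states `ξ`;
`x k i` and `u k i` are the state and the input of the `i`-th subsystem at time `k`. -/
def IsTrajectory {n m v : ℕ} (A : Matrix (Fin n) (Fin n) ℝ) (B : Matrix (Fin n) (Fin m) ℝ)
    (ξ : Fin v → Fin n → ℝ) (x : ℕ → Fin v → Fin n → ℝ) (u : ℕ → Fin v → Fin m → ℝ) : Prop :=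
  x 0 = ξ ∧ ∀ k i, x (k + 1) i = A *ᵥ x k i + B *ᵥ u k i

/-- The imposed constraint: the average control is `Fbar` times the average state, at all times. -/
def SatisfiesConstraint {n m v : ℕ} (μ : Fin v → ℝ) (Fbar : Matrix (Fin m) (Fin n) ℝ)
    (x : ℕ → Fin v → Fin n → ℝ) (u : ℕ → Fin v → Fin m → ℝ) : Prop :=
  ∀ k, average μ (u k) = Fbar *ᵥ average μ (x k)

/-- The infinite-horizon cost, with values in `[0, ∞]`. For `Q ≥ 0` and `R > 0` every summand is
a nonnegative real number, so `ENNReal.ofReal` does not alter it. -/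
def cost {n m v : ℕ} (Q : Matrix (Fin n) (Fin n) ℝ) (R : Matrix (Fin m) (Fin m) ℝ)
    (x : ℕ → Fin v → Fin n → ℝ) (u : ℕ → Fin v → Fin m → ℝ) : ℝ≥0∞ :=
  ∑ i, ∑' k, ENNReal.ofReal (x k i ⬝ᵥ Q *ᵥ x k i + u k i ⬝ᵥ R *ᵥ u k i)

/-- The linear distributed feedback with constant gains: subsystem `i` applies
`L i * (own state) + Lbar i * (average state)`. -/
def feedback {n m v : ℕ} (μ : Fin v → ℝ) (L Lbar : Fin v → Matrix (Fin m) (Fin n) ℝ)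
    (z : Fin v → Fin n → ℝ) : Fin v → Fin m → ℝ :=
  fun i => L i *ᵥ z i + Lbar i *ᵥ average μ z

/-- The states of the closed loop under the feedback with gains `L`, `Lbar`, started at `ξ`. -/
def closedLoopState {n m v : ℕ} (A : Matrix (Fin n) (Fin n) ℝ) (B : Matrix (Fin n) (Fin m) ℝ)
    (μ : Fin v → ℝ) (L Lbar : Fin v → Matrix (Fin m) (Fin n) ℝ) (ξ : Fin v → Fin n → ℝ) :
    ℕ → Fin v → Fin n → ℝ
  | 0 => ξ
  | k + 1 => fun i =>
      A *ᵥ closedLoopState A B μ L Lbar ξ k i +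
        B *ᵥ feedback μ L Lbar (closedLoopState A B μ L Lbar ξ k) i

/-- The inputs of the closed loop under the feedback with gains `L`, `Lbar`, started at `ξ`. -/
def closedLoopInput {n m v : ℕ} (A : Matrix (Fin n) (Fin n) ℝ) (B : Matrix (Fin n) (Fin m) ℝ)
    (μ : Fin v → ℝ) (L Lbar : Fin v → Matrix (Fin m) (Fin n) ℝ) (ξ : Fin v → Fin n → ℝ) :
    ℕ → Fin v → Fin m → ℝ :=
  fun k => feedback μ L Lbar (closedLoopState A B μ L Lbar ξ k)

/-- The feedback with gains `L`, `Lbar` respects the constraint with gain `Fbar` and makes the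
closed loop asymptotically stable: from all initial states, all subsystem states tend to `0`. -/
def Stabilizes {n m v : ℕ} (A : Matrix (Fin n) (Fin n) ℝ) (B : Matrix (Fin n) (Fin m) ℝ)
    (μ : Fin v → ℝ) (Fbar : Matrix (Fin m) (Fin n) ℝ)
    (L Lbar : Fin v → Matrix (Fin m) (Fin n) ℝ) : Prop :=
  ∀ ξ : Fin v → Fin n → ℝ,
    SatisfiesConstraint μ Fbar (closedLoopState A B μ L Lbar ξ)
        (closedLoopInput A B μ L Lbar ξ) ∧
      ∀ i, Tendsto (fun k => closedLoopState A B μ L Lbar ξ k i) atTop (𝓝 0)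

/-- Stabilizability by a linear distributed controller, subject to the constraint. -/
def Stabilizable {n m v : ℕ} (A : Matrix (Fin n) (Fin n) ℝ) (B : Matrix (Fin n) (Fin m) ℝ)
    (μ : Fin v → ℝ) (Fbar : Matrix (Fin m) (Fin n) ℝ) : Prop :=
  ∃ L Lbar : Fin v → Matrix (Fin m) (Fin n) ℝ, Stabilizes A B μ Fbar L Lbar

/-- Stability of a matrix in discrete time: all complex eigenvalues lie in the open unit disc. -/
def IsStable {n : ℕ} (M : Matrix (Fin n) (Fin n) ℝ) : Prop :=
  ∀ z ∈ spectrum ℂ (M.map (algebraMap ℝ ℂ)), ‖z‖ < 1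

/-- Observability of `(A, C)`: an initial state whose free output `C A ^ k x` vanishes identically
is zero. -/
def IsObservable {n p : ℕ} (A : Matrix (Fin n) (Fin n) ℝ) (C : Matrix (Fin p) (Fin n) ℝ) : Prop :=
  ∀ x : Fin n → ℝ, (∀ k : ℕ, C *ᵥ (A ^ k *ᵥ x) = 0) → x = 0

/-- `(P, Pbar)` solves the coupled algebraic Riccati equations. -/
def SolvesARE {n m : ℕ} (A : Matrix (Fin n) (Fin n) ℝ) (B : Matrix (Fin n) (Fin m) ℝ)
    (Fbar : Matrix (Fin m) (Fin n) ℝ) (Q : Matrix (Fin n) (Fin n) ℝ)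
    (R : Matrix (Fin m) (Fin m) ℝ) (P Pbar : Matrix (Fin n) (Fin n) ℝ) : Prop :=
  P = Q + Aᵀ * P * A - Aᵀ * P * B * (R + Bᵀ * P * B)⁻¹ * Bᵀ * P * A ∧
  Pbar = (A + B * Fbar)ᵀ * Pbar * (A + B * Fbar) + Fbarᵀ * (R + Bᵀ * P * B) * Fbar
    + Aᵀ * P * B * (R + Bᵀ * P * B)⁻¹ * Bᵀ * P * A + Aᵀ * P * B * Fbar + Fbarᵀ * Bᵀ * P * A

/-- A solution of the coupled Riccati equations with `P + Pbar ≥ P > 0`, in the order of symmetric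
matrices. -/
def IsPosDefSolution {n m : ℕ} (A : Matrix (Fin n) (Fin n) ℝ) (B : Matrix (Fin n) (Fin m) ℝ)
    (Fbar : Matrix (Fin m) (Fin n) ℝ) (Q : Matrix (Fin n) (Fin n) ℝ)
    (R : Matrix (Fin m) (Fin m) ℝ) (P Pbar : Matrix (Fin n) (Fin n) ℝ) : Prop :=
  SolvesARE A B Fbar Q R P Pbar ∧ P.PosDef ∧ ((P + Pbar) - P).PosSemidef

/-- The gain `K = -(R + B' P B)⁻¹ B' P A`. -/
def gainK {n m : ℕ} (A : Matrix (Fin n) (Fin n) ℝ) (B : Matrix (Fin n) (Fin m) ℝ)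
    (R : Matrix (Fin m) (Fin m) ℝ) (P : Matrix (Fin n) (Fin n) ℝ) : Matrix (Fin m) (Fin n) ℝ :=
  -((R + Bᵀ * P * B)⁻¹ * Bᵀ * P * A)

/-- The gain `Kbar = Fbar - K`. -/
def gainKbar {n m : ℕ} (A : Matrix (Fin n) (Fin n) ℝ) (B : Matrix (Fin n) (Fin m) ℝ)
    (Fbar : Matrix (Fin m) (Fin n) ℝ) (R : Matrix (Fin m) (Fin m) ℝ)
    (P : Matrix (Fin n) (Fin n) ℝ) : Matrix (Fin m) (Fin n) ℝ :=
  Fbar - gainK A B R P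

/-- The claimed optimal value `∑ i, ξ i' P ξ i + (∑ i, μ i ^ 2)⁻¹ ξbar' Pbar ξbar`. -/
def optimalValue {n v : ℕ} (μ : Fin v → ℝ) (P Pbar : Matrix (Fin n) (Fin n) ℝ)
    (ξ : Fin v → Fin n → ℝ) : ℝ :=
  ∑ i, ξ i ⬝ᵥ P *ᵥ ξ i + (1 / ∑ j, μ j ^ 2) * (average μ ξ ⬝ᵥ Pbar *ᵥ average μ ξ)

end

end DistributedLQ

/-
Completing the square in the input shows that under the constraint the value
`∑ i, x i' P x i + (∑ j, μ j ^ 2)⁻¹ xbar' Pbar xbar` decreases in one step by at most the stage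
cost, with equality exactly for the stated feedback: writing `K` and `Kbar = Fbar - K`, the
constraint fixes the average of `u i - K x i` to be `Kbar xbar`, so the weighted Cauchy–Schwarz
inequality gives the smallest `∑ i, (u i - K x i)' (R + B' P B) (u i - K x i)`, and the equation
for `Pbar` accounts for that minimum. Summing over time, finite cost forces the states to `0`,
since by observability a state is recovered from finitely many outputs and inputs.

The equation for `P` does not involve `Fbar`. Value iteration from `0` increases and is bounded by
the cost of the feedback `Fbar`, hence converges to a solution when `A + B Fbar` is stable; two
solutions `P`, `P'` with stable closed loops `M`, `M'` satisfy `P - P' = M'ᵀ (P - P') M`, which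
forces `P = P'`. Given `P`, the equation for `Pbar` is a Stein equation with the stable matrix
`A + B Fbar`.

Conversely, the average state of a constrained system evolves by `A + B Fbar` from an arbitrary
initial value, so stabilizability forces this matrix to be stable.
-/

namespace DistributedLQ

open scoped MatrixOrder

section QuadraticForm

variable {ι κ α : Type*} {l : Filter α}

theorem transpose_eq_of_posSemidef {M : Matrix ι ι ℝ} (hM : M.PosSemidef) : Mᵀ = M := by
  simpa only [conjTranspose_eq_transpose_of_trivial] using hM.isHermitian.eq

theorem posSemidef_transpose_mul_mul [Fintype ι] [Finite κ] {M : Matrix ι ι ℝ}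
    (hM : M.PosSemidef) (N : Matrix ι κ ℝ) : (Nᵀ * M * N).PosSemidef := by
  simpa only [conjTranspose_eq_transpose_of_trivial] using hM.conjTranspose_mul_mul_same N

theorem transpose_mul_mul_le [Fintype ι] [Finite κ] {M M' : Matrix ι ι ℝ} (h : M ≤ M')
    (N : Matrix ι κ ℝ) : Nᵀ * M * N ≤ Nᵀ * M' * N := by
  rw [le_iff, ← Matrix.sub_mul, ← Matrix.mul_sub]
  exact posSemidef_transpose_mul_mul (le_iff.1 h) N

variable [Fintype ι] [Fintype κ]

theorem quadratic_nonneg {M : Matrix ι ι ℝ} (hM : M.PosSemidef) (x : ι → ℝ) :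
    0 ≤ x ⬝ᵥ M *ᵥ x := by
  simpa only [star_trivial] using hM.dotProduct_mulVec_nonneg x

theorem quadratic_eq_zero_iff {M : Matrix ι ι ℝ} (hM : M.PosSemidef) {x : ι → ℝ} :
    x ⬝ᵥ M *ᵥ x = 0 ↔ M *ᵥ x = 0 := by
  simpa only [star_trivial] using hM.dotProduct_mulVec_zero_iff x

theorem posSemidef_of_quadratic_nonneg {M : Matrix ι ι ℝ} (hM : Mᵀ = M)
    (h : ∀ x, 0 ≤ x ⬝ᵥ M *ᵥ x) : M.PosSemidef :=
  .of_dotProduct_mulVec_nonneg ((conjTranspose_eq_transpose_of_trivial M).trans hM)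
    fun x => by simpa only [star_trivial] using h x

theorem quadratic_mono {M M' : Matrix ι ι ℝ} (h : M ≤ M') (x : ι → ℝ) :
    x ⬝ᵥ M *ᵥ x ≤ x ⬝ᵥ M' *ᵥ x := by
  simpa only [sub_mulVec, dotProduct_sub, sub_nonneg] using quadratic_nonneg (le_iff.1 h) x

theorem quadratic_transpose_mul_mul (M : Matrix κ κ ℝ) (N : Matrix κ ι ℝ) (x : ι → ℝ) :
    x ⬝ᵥ (Nᵀ * M * N) *ᵥ x = (N *ᵥ x) ⬝ᵥ M *ᵥ (N *ᵥ x) := by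
  rw [Matrix.mul_assoc, ← mulVec_mulVec, ← mulVec_mulVec, dotProduct_mulVec, vecMul_transpose]

theorem quadratic_sub {M : Matrix ι ι ℝ} (hM : Mᵀ = M) (x y : ι → ℝ) :
    (x - y) ⬝ᵥ M *ᵥ (x - y) = x ⬝ᵥ M *ᵥ x - 2 * (y ⬝ᵥ M *ᵥ x) + y ⬝ᵥ M *ᵥ y := by
  have hxy : x ⬝ᵥ M *ᵥ y = y ⬝ᵥ M *ᵥ x := by
    rw [dotProduct_mulVec, ← mulVec_transpose, hM, dotProduct_comm]
  simp only [mulVec_sub, dotProduct_sub, sub_dotProduct, hxy]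
  ring

theorem tendsto_quadratic_zero (M : Matrix ι ι ℝ) {x : α → ι → ℝ} (hx : Tendsto x l (𝓝 0)) :
    Tendsto (fun k => x k ⬝ᵥ M *ᵥ x k) l (𝓝 0) := by
  have hcont : Continuous fun x : ι → ℝ => x ⬝ᵥ M *ᵥ x := by fun_prop
  simpa [Function.comp_def] using (hcont.tendsto 0).comp hx

theorem tendsto_mulVec_zero_of_quadratic {M : Matrix ι ι ℝ} (hM : M.PosSemidef) {x : α → ι → ℝ}
    (hx : Tendsto (fun k => x k ⬝ᵥ M *ᵥ x k) l (𝓝 0)) :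
    Tendsto (fun k => M *ᵥ x k) l (𝓝 0) := by
  classical
  obtain ⟨N, rfl⟩ : ∃ N : Matrix ι ι ℝ, M = Nᵀ * N := by
    simpa only [star_eq_conjTranspose, conjTranspose_eq_transpose_of_trivial] using
      CStarAlgebra.nonneg_iff_eq_star_mul_self.1 hM.nonneg
  have hNx : Tendsto (fun k => N *ᵥ x k) l (𝓝 0) := by
    refine tendsto_pi_nhds.2 fun i => ?_
    have hsq : Tendsto (fun k => (N *ᵥ x k) i ^ 2) l (𝓝 0) := by
      refine squeeze_zero (fun k => sq_nonneg _) (fun k => ?_) hx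
      rw [← Matrix.mul_one Nᵀ, quadratic_transpose_mul_mul, one_mulVec, sq]
      exact Finset.single_le_sum (f := fun j => (N *ᵥ x k) j * (N *ᵥ x k) j)
        (fun j _ => mul_self_nonneg _) (Finset.mem_univ i)
    refine (tendsto_zero_iff_abs_tendsto_zero _).2 ?_
    simpa only [Real.sqrt_sq_eq_abs, Real.sqrt_zero, Function.comp_def] using hsq.sqrt
  have hcont : Continuous fun y : ι → ℝ => Nᵀ *ᵥ y := by fun_prop
  simpa [Function.comp_def, mulVec_mulVec] using (hcont.tendsto 0).comp hNx

theorem tendsto_zero_of_quadratic {M : Matrix ι ι ℝ} (hM : M.PosDef) {x : α → ι → ℝ}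
    (hx : Tendsto (fun k => x k ⬝ᵥ M *ᵥ x k) l (𝓝 0)) : Tendsto x l (𝓝 0) := by
  classical
  have hcont : Continuous fun y : ι → ℝ => M⁻¹ *ᵥ y := by fun_prop
  have hMx := (hcont.tendsto 0).comp (tendsto_mulVec_zero_of_quadratic hM.posSemidef hx)
  simpa [Function.comp_def, mulVec_mulVec,
    nonsing_inv_mul M ((isUnit_iff_isUnit_det M).1 hM.isUnit)] using hMx

theorem apply_eq_quadratic [DecidableEq ι] {M : Matrix ι ι ℝ} (hM : Mᵀ = M) (i j : ι) :
    M i j = (Pi.single i 1 ⬝ᵥ M *ᵥ Pi.single i 1 + Pi.single j 1 ⬝ᵥ M *ᵥ Pi.single j 1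
      - (Pi.single i 1 - Pi.single j 1) ⬝ᵥ M *ᵥ (Pi.single i 1 - Pi.single j 1)) / 2 := by
  have hij : Pi.single j 1 ⬝ᵥ M *ᵥ Pi.single i 1 = M i j := by
    rw [mulVec_single_one, single_one_dotProduct, col_apply, ← transpose_apply M, hM]
  rw [quadratic_sub hM, hij]
  ring

end QuadraticForm

theorem posSemidef_of_tendsto {ι α : Type*} [Finite ι] {l : Filter α} [NeBot l]
    {X : α → Matrix ι ι ℝ} {M : Matrix ι ι ℝ} (hX : ∀ k, (X k).PosSemidef)
    (hM : Tendsto X l (𝓝 M)) : M.PosSemidef := by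
  have := Fintype.ofFinite ι
  refine posSemidef_of_quadratic_nonneg ?_ fun x => ?_
  · have hcont : Continuous fun Y : Matrix ι ι ℝ => Yᵀ := by fun_prop
    refine tendsto_nhds_unique (((hcont.tendsto M).comp hM).congr fun k => ?_) hM
    exact transpose_eq_of_posSemidef (hX k)
  · have hcont : Continuous fun Y : Matrix ι ι ℝ => x ⬝ᵥ Y *ᵥ x := by fun_prop
    exact ge_of_tendsto' ((hcont.tendsto M).comp hM) fun k => quadratic_nonneg (hX k) x

theorem exists_tendsto_of_monotone_of_le {ι : Type*} [Finite ι] {X : ℕ → Matrix ι ι ℝ}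
    {T : Matrix ι ι ℝ} (hX : ∀ k, (X k)ᵀ = X k) (hmono : Monotone X) (hle : ∀ k, X k ≤ T) :
    ∃ M, Tendsto X atTop (𝓝 M) := by
  classical
  have := Fintype.ofFinite ι
  have hquad (x : ι → ℝ) : ∃ a, Tendsto (fun k => x ⬝ᵥ X k *ᵥ x) atTop (𝓝 a) :=
    ⟨_, tendsto_atTop_ciSup (fun _ _ h => quadratic_mono (hmono h) x)
      ⟨x ⬝ᵥ T *ᵥ x, by rintro _ ⟨k, rfl⟩; exact quadratic_mono (hle k) x⟩⟩
  choose q hq using hquad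
  refine ⟨of fun i j =>
    (q (Pi.single i 1) + q (Pi.single j 1) - q (Pi.single i 1 - Pi.single j 1)) / 2, ?_⟩
  refine tendsto_pi_nhds.2 fun i => tendsto_pi_nhds.2 fun j => ?_
  simp only [fun k => apply_eq_quadratic (hX k) i j]
  exact (((hq _).add (hq _)).sub (hq _)).div_const 2

section Stability

theorem isTopologicallyNilpotent_iff_spectrum {𝒜 : Type*} [NormedRing 𝒜] [NormedAlgebra ℂ 𝒜]
    [CompleteSpace 𝒜] (a : 𝒜) :
    IsTopologicallyNilpotent a ↔ ∀ z ∈ spectrum ℂ a, ‖z‖ < 1 := by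
  constructor
  · intro ha z hz
    have hbound (k : ℕ) : ‖z‖ ^ k ≤ ‖a ^ k‖ * ‖(1 : 𝒜)‖ := by
      rw [← norm_pow]
      exact spectrum.norm_le_norm_mul_of_mem (spectrum.pow_mem_pow a k hz)
    have hpow : Tendsto (fun k => ‖z‖ ^ k) atTop (𝓝 0) :=
      squeeze_zero (fun k => by positivity) hbound (by simpa using ha.norm.mul_const ‖(1 : 𝒜)‖)
    simpa using tendsto_pow_atTop_nhds_zero_iff.1 hpow
  · intro ha
    rcases subsingleton_or_nontrivial 𝒜 with _ | _
    · exact Subsingleton.elim (0 : 𝒜) a ▸ .zero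
    have hrad : spectralRadius ℂ a < 1 :=
      mod_cast spectrum.spectralRadius_lt_of_forall_lt a (r := 1) ha
    obtain ⟨r, hr, hr1⟩ := ENNReal.lt_iff_exists_nnreal_btwn.1 hrad
    have hroot :=
      (spectrum.pow_nnnorm_pow_one_div_tendsto_nhds_spectralRadius a).eventually_lt_const hr
    refine squeeze_zero_norm' ?_ (tendsto_pow_atTop_nhds_zero_of_lt_one r.2 (mod_cast hr1))
    filter_upwards [hroot, eventually_gt_atTop 0] with k hk hk0
    rw [one_div, ENNReal.rpow_inv_lt_iff (by positivity), ENNReal.rpow_natCast] at hk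
    exact mod_cast hk.le

theorem isTopologicallyNilpotent_map_algebraMap {ι : Type*} [Fintype ι] [DecidableEq ι]
    {M : Matrix ι ι ℝ} :
    IsTopologicallyNilpotent (M.map (algebraMap ℝ ℂ)) ↔ IsTopologicallyNilpotent M := by
  simp only [IsTopologicallyNilpotent, ← Matrix.map_pow]
  refine tendsto_pi_nhds.trans <| Iff.trans ?_ tendsto_pi_nhds.symm
  refine forall_congr' fun i => tendsto_pi_nhds.trans <| Iff.trans ?_ tendsto_pi_nhds.symm
  exact forall_congr' fun j => tendsto_ofReal_iff (x := 0)

open scoped Matrix.Norms.L2Operator in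
theorem isStable_iff_isTopologicallyNilpotent {n : ℕ} {M : Matrix (Fin n) (Fin n) ℝ} :
    IsStable M ↔ IsTopologicallyNilpotent M :=
  (isTopologicallyNilpotent_iff_spectrum _).symm.trans isTopologicallyNilpotent_map_algebraMap

theorem tendsto_zero_iff_mulVec {ι κ α : Type*} [Fintype κ] {l : Filter α} {X : α → Matrix ι κ ℝ} :
    Tendsto X l (𝓝 0) ↔ ∀ x, Tendsto (fun k => X k *ᵥ x) l (𝓝 0) := by
  classical
  refine ⟨fun hX x => ?_, fun h => tendsto_pi_nhds.2 fun i => tendsto_pi_nhds.2 fun j => ?_⟩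
  · have hcont : Continuous fun Y : Matrix ι κ ℝ => Y *ᵥ x := by fun_prop
    simpa [Function.comp_def] using (hcont.tendsto 0).comp hX
  · simpa using tendsto_pi_nhds.1 (h (Pi.single j 1)) i

variable {ι κ : Type*} [Fintype ι] [DecidableEq ι] [Fintype κ] [DecidableEq κ]

theorem eq_zero_of_stein {M : Matrix ι ι ℝ} {N : Matrix κ κ ℝ} {D : Matrix ι κ ℝ}
    (hM : IsTopologicallyNilpotent M) (hN : IsTopologicallyNilpotent N) (hD : D = Mᵀ * D * N) :
    D = 0 := by
  have hpow (k : ℕ) : D = (M ^ k)ᵀ * D * N ^ k := by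
    induction k with
    | zero => simp
    | succ k ih =>
      conv_lhs => rw [ih, hD]
      simp only [pow_succ' M, pow_succ' N, transpose_mul, Matrix.mul_assoc]
  have hcont : Continuous fun X : Matrix ι ι ℝ × Matrix κ κ ℝ => X.1ᵀ * D * X.2 := by fun_prop
  have hlim := (hcont.tendsto (0, 0)).comp (hM.prodMk_nhds hN)
  simp only [Function.comp_def, ← hpow, transpose_zero, Matrix.zero_mul] at hlim
  exact tendsto_nhds_unique tendsto_const_nhds hlim

theorem existsUnique_stein {M : Matrix ι ι ℝ} {N : Matrix κ κ ℝ}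
    (hM : IsTopologicallyNilpotent M) (hN : IsTopologicallyNilpotent N) (W : Matrix ι κ ℝ) :
    ∃! T : Matrix ι κ ℝ, T = Mᵀ * T * N + W := by
  let Φ : Matrix ι κ ℝ →ₗ[ℝ] Matrix ι κ ℝ :=
    LinearMap.id - (mulRightLinearMap ι ℝ N) ∘ₗ (mulLeftLinearMap κ ℝ Mᵀ)
  have hΦ (T : Matrix ι κ ℝ) : Φ T = T - Mᵀ * T * N := rfl
  have hinj : Function.Injective Φ := (injective_iff_map_eq_zero Φ).2 fun D hD =>
    eq_zero_of_stein hM hN (sub_eq_zero.1 hD)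
  have hbij : Function.Bijective Φ := ⟨hinj, LinearMap.injective_iff_surjective.1 hinj⟩
  simpa only [hΦ, sub_eq_iff_eq_add'] using hbij.existsUnique W

theorem posSemidef_of_stein {M T W : Matrix ι ι ℝ} (hM : IsTopologicallyNilpotent M)
    (hW : W.PosSemidef) (hT : T = Mᵀ * T * M + W) : T.PosSemidef := by
  refine posSemidef_of_quadratic_nonneg ?_ fun x => ?_
  · refine (existsUnique_stein hM hM W).unique ?_ hT
    conv_lhs => rw [hT]
    simp only [transpose_add, transpose_mul, transpose_transpose, transpose_eq_of_posSemidef hW,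
      Matrix.mul_assoc]
  · have hstep (y : ι → ℝ) : (M *ᵥ y) ⬝ᵥ T *ᵥ (M *ᵥ y) ≤ y ⬝ᵥ T *ᵥ y := by
      conv_rhs => rw [hT, add_mulVec, dotProduct_add, quadratic_transpose_mul_mul]
      exact le_add_of_nonneg_right (quadratic_nonneg hW y)
    have hanti : Antitone fun k => (M ^ k *ᵥ x) ⬝ᵥ T *ᵥ (M ^ k *ᵥ x) :=
      antitone_nat_of_succ_le fun k => by
        simpa only [pow_succ', ← mulVec_mulVec] using hstep (M ^ k *ᵥ x)
    have hlim := tendsto_quadratic_zero T (tendsto_zero_iff_mulVec.1 hM x)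
    simpa using hanti.le_of_tendsto hlim 0

end Stability

section Observability

variable {n m p : ℕ} {A : Matrix (Fin n) (Fin n) ℝ} {B : Matrix (Fin n) (Fin m) ℝ}
  {C : Matrix (Fin p) (Fin n) ℝ}

theorem IsObservable.transpose_mul_self (hobs : IsObservable A C) : IsObservable A (Cᵀ * C) :=
  fun x hx => hobs x fun k => by
    simpa only [conjTranspose_eq_transpose_of_trivial] using
      (conjTranspose_mul_self_mulVec_eq_zero C (A ^ k *ᵥ x)).1 (by
        simpa only [conjTranspose_eq_transpose_of_trivial] using hx k)

theorem IsObservable.tendsto_zero (hobs : IsObservable A C) {x : ℕ → Fin n → ℝ}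
    {u : ℕ → Fin m → ℝ} (hx : ∀ k, x (k + 1) = A *ᵥ x k + B *ᵥ u k)
    (hCx : Tendsto (fun k => C *ᵥ x k) atTop (𝓝 0)) (hu : Tendsto u atTop (𝓝 0)) :
    Tendsto x atTop (𝓝 0) := by
  let Φ : (Fin n → ℝ) →ₗ[ℝ] ℕ → Fin p → ℝ := LinearMap.pi fun j => (C * A ^ j).mulVecLin
  have hΦ (y : Fin n → ℝ) (j : ℕ) : Φ y j = (C * A ^ j) *ᵥ y := rfl
  have hker : LinearMap.ker Φ = ⊥ := LinearMap.ker_eq_bot'.2 fun y hy => hobs y fun j => by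
    rw [mulVec_mulVec, ← hΦ, hy, Pi.zero_apply]
  have hemb := LinearMap.isClosedEmbedding_of_injective hker
  rw [hemb.isInducing.tendsto_nhds_iff, map_zero, tendsto_pi_nhds]
  intro j
  simp only [Function.comp_apply, hΦ, Pi.zero_apply]
  induction j with
  | zero => simpa using hCx
  | succ j ih =>
    have hshift (k : ℕ) : (C * A ^ (j + 1)) *ᵥ x k =
        (C * A ^ j) *ᵥ x (k + 1) - (C * A ^ j * B) *ᵥ u k := by
      rw [hx, mulVec_add, mulVec_mulVec, mulVec_mulVec, pow_succ, Matrix.mul_assoc C,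
        add_sub_cancel_right]
    have hcont : Continuous fun w : Fin m → ℝ => (C * A ^ j * B) *ᵥ w := by fun_prop
    have hBu := (hcont.tendsto 0).comp hu
    simpa [hshift, Function.comp_def] using (ih.comp (tendsto_add_atTop_nat 1)).sub hBu

end Observability

section Telescoping

variable {s V : ℕ → ℝ}

theorem tendsto_zero_of_telescoping (hs : ∀ k, 0 ≤ s k) (hV : ∀ k, 0 ≤ V k)
    (h : ∀ k, V k = s k + V (k + 1)) : Tendsto s atTop (𝓝 0) := by
  have hanti : Antitone V := antitone_nat_of_succ_le fun k => by linarith [hs k, h k]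
  have hlim := tendsto_atTop_ciInf hanti ⟨0, by rintro _ ⟨k, rfl⟩; exact hV k⟩
  have hsub := hlim.sub (hlim.comp (tendsto_add_atTop_nat 1))
  rw [sub_self] at hsub
  exact hsub.congr fun k => sub_eq_of_eq_add (h k)

theorem hasSum_of_telescoping (hs : ∀ k, 0 ≤ s k) (hV : Tendsto V atTop (𝓝 0))
    (h : ∀ k, V k = s k + V (k + 1)) : HasSum s (V 0) := by
  have hsum (N : ℕ) : ∑ k ∈ Finset.range N, s k = V 0 - V N := by
    rw [← Finset.sum_range_sub']
    exact Finset.sum_congr rfl fun k _ => eq_sub_of_add_eq (h k).symm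
  rw [hasSum_iff_tendsto_nat_of_nonneg hs]
  simpa only [hsum, sub_zero] using hV.const_sub (V 0)

theorem ofReal_le_tsum_of_telescoping (hs : ∀ k, 0 ≤ s k) (hV : Summable s → Tendsto V atTop (𝓝 0))
    (h : ∀ k, V k ≤ s k + V (k + 1)) : ENNReal.ofReal (V 0) ≤ ∑' k, ENNReal.ofReal (s k) := by
  by_cases hsum : Summable s
  · rw [← ENNReal.ofReal_tsum_of_nonneg hs hsum]
    refine ENNReal.ofReal_le_ofReal ?_
    have hpartial (N : ℕ) : V 0 - V N ≤ ∑ k ∈ Finset.range N, s k := by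
      rw [← Finset.sum_range_sub']
      exact Finset.sum_le_sum fun k _ => sub_le_iff_le_add.2 (h k)
    simpa only [sub_zero] using
      le_of_tendsto_of_tendsto' ((hV hsum).const_sub (V 0)) hsum.tendsto_sum_tsum_nat hpartial
  · have htop : ∑' k, ENNReal.ofReal (s k) = ⊤ := by
      by_contra hne
      exact hsum ((ENNReal.summable_toReal hne).congr fun k => ENNReal.toReal_ofReal (hs k))
    exact htop ▸ le_top

end Telescoping

section StageCost

/-- The cost of one step of a single system, from the state `x` with the input `u`. -/
def stageCost {ι κ : Type*} [Fintype ι] [Fintype κ] (Q : Matrix ι ι ℝ) (R : Matrix κ κ ℝ)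
    (x : ι → ℝ) (u : κ → ℝ) : ℝ :=
  x ⬝ᵥ Q *ᵥ x + u ⬝ᵥ R *ᵥ u

theorem stageCost_nonneg {ι κ : Type*} [Fintype ι] [Fintype κ] {Q : Matrix ι ι ℝ}
    {R : Matrix κ κ ℝ} (hQ : Q.PosSemidef) (hR : R.PosSemidef) (x : ι → ℝ) (u : κ → ℝ) :
    0 ≤ stageCost Q R x u :=
  add_nonneg (quadratic_nonneg hQ x) (quadratic_nonneg hR u)

variable {n m : ℕ} {A : Matrix (Fin n) (Fin n) ℝ} {B : Matrix (Fin n) (Fin m) ℝ}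
  {Q : Matrix (Fin n) (Fin n) ℝ} {R : Matrix (Fin m) (Fin m) ℝ}

theorem IsObservable.tendsto_zero_of_stageCost (hobs : IsObservable A Q) (hQ : Q.PosSemidef)
    (hR : R.PosDef) {x : ℕ → Fin n → ℝ} {u : ℕ → Fin m → ℝ}
    (hx : ∀ k, x (k + 1) = A *ᵥ x k + B *ᵥ u k)
    (hcost : Tendsto (fun k => stageCost Q R (x k) (u k)) atTop (𝓝 0)) :
    Tendsto x atTop (𝓝 0) := by
  have hQx : Tendsto (fun k => x k ⬝ᵥ Q *ᵥ x k) atTop (𝓝 0) :=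
    squeeze_zero (fun k => quadratic_nonneg hQ _)
      (fun k => le_add_of_nonneg_right (quadratic_nonneg hR.posSemidef _)) hcost
  have hRu : Tendsto (fun k => u k ⬝ᵥ R *ᵥ u k) atTop (𝓝 0) :=
    squeeze_zero (fun k => quadratic_nonneg hR.posSemidef _)
      (fun k => le_add_of_nonneg_left (quadratic_nonneg hQ _)) hcost
  exact hobs.tendsto_zero hx (tendsto_mulVec_zero_of_quadratic hQ hQx)
    (tendsto_zero_of_quadratic hR hRu)

end StageCost

section Riccati

variable {n m : ℕ}

/-- The Riccati operator, whose fixed points are the solutions of the algebraic Riccati equation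
for a single system. -/
noncomputable def riccati (A : Matrix (Fin n) (Fin n) ℝ) (B : Matrix (Fin n) (Fin m) ℝ)
    (Q : Matrix (Fin n) (Fin n) ℝ) (R : Matrix (Fin m) (Fin m) ℝ) (P : Matrix (Fin n) (Fin n) ℝ) :
    Matrix (Fin n) (Fin n) ℝ :=
  Q + Aᵀ * P * A - Aᵀ * P * B * (R + Bᵀ * P * B)⁻¹ * Bᵀ * P * A

/-- The policy evaluation operator of dynamic programming: if `P` is the quadratic cost to go,
then `policyStep A B Q R L P` is the cost of one step with the input `L *ᵥ x` and proceeding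
at cost `P`. The Riccati operator is its minimum over the gain `L`. -/
def policyStep (A : Matrix (Fin n) (Fin n) ℝ) (B : Matrix (Fin n) (Fin m) ℝ)
    (Q : Matrix (Fin n) (Fin n) ℝ) (R : Matrix (Fin m) (Fin m) ℝ) (L : Matrix (Fin m) (Fin n) ℝ)
    (P : Matrix (Fin n) (Fin n) ℝ) : Matrix (Fin n) (Fin n) ℝ :=
  Q + Lᵀ * R * L + (A + B * L)ᵀ * P * (A + B * L)

variable {A : Matrix (Fin n) (Fin n) ℝ} {B : Matrix (Fin n) (Fin m) ℝ}
  {Q : Matrix (Fin n) (Fin n) ℝ} {R : Matrix (Fin m) (Fin m) ℝ} {P P' : Matrix (Fin n) (Fin n) ℝ}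

theorem posDef_add_transpose_mul_mul (hR : R.PosDef) (hP : P.PosSemidef) :
    (R + Bᵀ * P * B).PosDef :=
  hR.add_posSemidef (posSemidef_transpose_mul_mul hP B)

theorem mul_gainK (hR : R.PosDef) (hP : P.PosSemidef) :
    (R + Bᵀ * P * B) * gainK A B R P = -(Bᵀ * P * A) := by
  have hdet := (isUnit_iff_isUnit_det _).1 (posDef_add_transpose_mul_mul (B := B) hR hP).isUnit
  rw [gainK, Matrix.mul_neg, Matrix.mul_assoc _ Bᵀ, Matrix.mul_assoc _ (Bᵀ * P),
    mul_nonsing_inv_cancel_left _ _ hdet]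

theorem transpose_gainK_mul (hR : R.PosDef) (hP : P.PosSemidef) :
    (gainK A B R P)ᵀ * (R + Bᵀ * P * B) = -(Aᵀ * P * B) := by
  have h := congrArg transpose (mul_gainK (A := A) (B := B) hR hP)
  rwa [transpose_mul, transpose_eq_of_posSemidef (posDef_add_transpose_mul_mul hR hP).posSemidef,
    transpose_neg, transpose_mul, transpose_mul, transpose_transpose,
    transpose_eq_of_posSemidef hP, ← Matrix.mul_assoc] at h

theorem riccati_eq_add_gainK :
    riccati A B Q R P = Q + Aᵀ * P * A + Aᵀ * P * B * gainK A B R P := by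
  simp only [riccati, gainK, Matrix.mul_neg, Matrix.mul_assoc, sub_eq_add_neg]

theorem completing_the_square (hR : R.PosDef) (hP : P.PosSemidef) {ι κ : Type*}
    (X : Matrix (Fin n) ι ℝ) (U : Matrix (Fin m) ι ℝ) (Y : Matrix (Fin n) κ ℝ)
    (V : Matrix (Fin m) κ ℝ) :
    Xᵀ * Q * Y + Uᵀ * R * V + (A * X + B * U)ᵀ * P * (A * Y + B * V) =
      Xᵀ * riccati A B Q R P * Y +
        (U - gainK A B R P * X)ᵀ * (R + Bᵀ * P * B) * (V - gainK A B R P * Y) := by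
  have hSK := mul_gainK (A := A) (B := B) hR hP
  have hKS := transpose_gainK_mul (A := A) (B := B) hR hP
  rw [riccati_eq_add_gainK]
  generalize gainK A B R P = K at *
  have hsquare : (U - K * X)ᵀ * (R + Bᵀ * P * B) * (V - K * Y) =
      Uᵀ * (R + Bᵀ * P * B) * V - Uᵀ * ((R + Bᵀ * P * B) * K) * Y
        - Xᵀ * (Kᵀ * (R + Bᵀ * P * B)) * V + Xᵀ * (Kᵀ * (R + Bᵀ * P * B)) * K * Y := by
    generalize R + Bᵀ * P * B = S
    simp only [transpose_sub, transpose_mul, Matrix.sub_mul, Matrix.mul_sub, Matrix.mul_assoc]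
    abel
  rw [hsquare, hSK, hKS]
  simp only [transpose_add, transpose_mul, Matrix.add_mul, Matrix.mul_add, Matrix.neg_mul,
    Matrix.mul_neg, Matrix.mul_assoc]
  abel

theorem transpose_replicateCol_mul_mul {ι : Type*} [Fintype ι] (M : Matrix ι ι ℝ) (x : ι → ℝ) :
    ((replicateCol Unit x)ᵀ * M * replicateCol Unit x) () () = x ⬝ᵥ M *ᵥ x := by
  rw [Matrix.mul_assoc, ← replicateCol_mulVec, transpose_replicateCol,
    replicateRow_mul_replicateCol_apply]

theorem stageCost_add_quadratic (hR : R.PosDef) (hP : P.PosSemidef) (x : Fin n → ℝ)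
    (u : Fin m → ℝ) :
    stageCost Q R x u + (A *ᵥ x + B *ᵥ u) ⬝ᵥ P *ᵥ (A *ᵥ x + B *ᵥ u) =
      x ⬝ᵥ riccati A B Q R P *ᵥ x +
        (u - gainK A B R P *ᵥ x) ⬝ᵥ (R + Bᵀ * P * B) *ᵥ (u - gainK A B R P *ᵥ x) := by
  have hnext : A * replicateCol Unit x + B * replicateCol Unit u =
      replicateCol Unit (A *ᵥ x + B *ᵥ u) := by
    rw [replicateCol_add, replicateCol_mulVec, replicateCol_mulVec]
  have hdev : replicateCol Unit u - gainK A B R P * replicateCol Unit x =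
      replicateCol Unit (u - gainK A B R P *ᵥ x) := by
    rw [← replicateCol_mulVec]
    rfl
  have h := congrFun₂ (completing_the_square (A := A) (B := B) (Q := Q) hR hP
    (replicateCol Unit x) (replicateCol Unit u) (replicateCol Unit x) (replicateCol Unit u)) () ()
  rw [hnext, hdev] at h
  simpa only [stageCost, Matrix.add_apply, transpose_replicateCol_mul_mul] using h

theorem policyStep_eq_riccati_add (hR : R.PosDef) (hP : P.PosSemidef)
    (L : Matrix (Fin m) (Fin n) ℝ) :
    policyStep A B Q R L P = riccati A B Q R P +
      (L - gainK A B R P)ᵀ * (R + Bᵀ * P * B) * (L - gainK A B R P) := by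
  simpa only [policyStep, transpose_one, Matrix.one_mul, Matrix.mul_one] using
    completing_the_square hR hP (1 : Matrix (Fin n) (Fin n) ℝ) L 1 L

theorem policyStep_gainK (hR : R.PosDef) (hP : P.PosSemidef) :
    policyStep A B Q R (gainK A B R P) P = riccati A B Q R P := by
  simp [policyStep_eq_riccati_add hR hP]

-- The square in `completing_the_square` vanishes as soon as one of the two gains is optimal.
theorem riccati_eq_of_gain (hR : R.PosDef) (hP : P.PosSemidef) (L : Matrix (Fin m) (Fin n) ℝ) :
    riccati A B Q R P =
      Q + Lᵀ * R * gainK A B R P + (A + B * L)ᵀ * P * (A + B * gainK A B R P) := by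
  simpa using (completing_the_square (A := A) (B := B) (Q := Q) hR hP
    (1 : Matrix (Fin n) (Fin n) ℝ) L 1 (gainK A B R P)).symm

theorem riccati_le_policyStep (hR : R.PosDef) (hP : P.PosSemidef) (L : Matrix (Fin m) (Fin n) ℝ) :
    riccati A B Q R P ≤ policyStep A B Q R L P := by
  rw [policyStep_eq_riccati_add hR hP]
  exact le_add_of_nonneg_right
    (posSemidef_transpose_mul_mul (posDef_add_transpose_mul_mul hR hP).posSemidef _).nonneg

theorem policyStep_mono (L : Matrix (Fin m) (Fin n) ℝ) : Monotone (policyStep A B Q R L) :=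
  fun _ _ h => add_le_add_right (transpose_mul_mul_le h _) _

theorem riccati_mono (hR : R.PosDef) (hP : P.PosSemidef) (hP' : P'.PosSemidef) (h : P ≤ P') :
    riccati A B Q R P ≤ riccati A B Q R P' :=
  calc riccati A B Q R P ≤ policyStep A B Q R (gainK A B R P') P := riccati_le_policyStep hR hP _
    _ ≤ policyStep A B Q R (gainK A B R P') P' := policyStep_mono _ h
    _ = riccati A B Q R P' := policyStep_gainK hR hP'

theorem posSemidef_riccati (hQ : Q.PosSemidef) (hR : R.PosDef) (hP : P.PosSemidef) :
    (riccati A B Q R P).PosSemidef := by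
  rw [← policyStep_gainK hR hP]
  exact (hQ.add (posSemidef_transpose_mul_mul hR.posSemidef _)).add
    (posSemidef_transpose_mul_mul hP _)

theorem continuousAt_riccati (hR : R.PosDef) (hP : P.PosSemidef) :
    ContinuousAt (riccati A B Q R) P := by
  have hdet :=
    ((isUnit_iff_isUnit_det _).1 (posDef_add_transpose_mul_mul (B := B) hR hP).isUnit).ne_zero
  have hinv : ContinuousAt Inv.inv (R + Bᵀ * P * B) :=
    continuousAt_matrix_inv _ (by rw [Ring.inverse_eq_inv']; exact continuousAt_inv₀ hdet)
  have hS : Continuous fun X : Matrix (Fin n) (Fin n) ℝ => R + Bᵀ * X * B := by fun_prop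
  have hriccati : Continuous fun Z : Matrix (Fin n) (Fin n) ℝ × Matrix (Fin m) (Fin m) ℝ =>
      Q + Aᵀ * Z.1 * A - Aᵀ * Z.1 * B * Z.2 * Bᵀ * Z.1 * A := by fun_prop
  exact hriccati.continuousAt.comp
    (f := fun X : Matrix (Fin n) (Fin n) ℝ => (X, (R + Bᵀ * X * B)⁻¹))
    (continuousAt_id.prodMk (hinv.comp (f := fun X => R + Bᵀ * X * B) hS.continuousAt))

theorem exists_isFixedPt_riccati (hQ : Q.PosSemidef) (hR : R.PosDef)
    {F : Matrix (Fin m) (Fin n) ℝ} (hF : IsStable (A + B * F)) :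
    ∃ P : Matrix (Fin n) (Fin n) ℝ, P.PosSemidef ∧ Function.IsFixedPt (riccati A B Q R) P := by
  have hF' := isStable_iff_isTopologicallyNilpotent.1 hF
  have hW := hQ.add (posSemidef_transpose_mul_mul hR.posSemidef F)
  obtain ⟨T, hT, -⟩ := existsUnique_stein hF' hF' (Q + Fᵀ * R * F)
  have hTpos := posSemidef_of_stein hF' hW hT
  have hTeval : policyStep A B Q R F T = T := (add_comm _ _).trans hT.symm
  let X (k : ℕ) : Matrix (Fin n) (Fin n) ℝ := (riccati A B Q R)^[k] 0
  have hXsucc (k : ℕ) : X (k + 1) = riccati A B Q R (X k) := Function.iterate_succ_apply' _ _ _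
  have hXpos (k : ℕ) : (X k).PosSemidef := by
    induction k with
    | zero => exact .zero
    | succ k ih => exact hXsucc k ▸ posSemidef_riccati hQ hR ih
  have hXmono : Monotone X := monotone_nat_of_le_succ fun k => by
    induction k with
    | zero => exact (hXpos 1).nonneg
    | succ k ih =>
      rw [hXsucc k, hXsucc (k + 1)]
      exact riccati_mono hR (hXpos k) (hXpos (k + 1)) ih
  have hXle (k : ℕ) : X k ≤ T := by
    induction k with
    | zero => exact hTpos.nonneg
    | succ k ih =>
      rw [hXsucc, ← hTeval]
      exact (riccati_le_policyStep hR (hXpos k) F).trans (policyStep_mono F ih)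
  obtain ⟨P, hP⟩ :=
    exists_tendsto_of_monotone_of_le (fun k => transpose_eq_of_posSemidef (hXpos k)) hXmono hXle
  have hPpos := posSemidef_of_tendsto hXpos hP
  exact ⟨P, hPpos, isFixedPt_of_tendsto_iterate hP (continuousAt_riccati hR hPpos)⟩

theorem quadratic_eq_of_isFixedPt_riccati (hR : R.PosDef) (hP : P.PosSemidef)
    (hfix : Function.IsFixedPt (riccati A B Q R) P) (x : Fin n → ℝ) :
    x ⬝ᵥ P *ᵥ x = stageCost Q R x (gainK A B R P *ᵥ x) +
      ((A + B * gainK A B R P) *ᵥ x) ⬝ᵥ P *ᵥ ((A + B * gainK A B R P) *ᵥ x) := by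
  have h := stageCost_add_quadratic (A := A) (B := B) (Q := Q) hR hP x (gainK A B R P *ᵥ x)
  rw [sub_self, zero_dotProduct, add_zero, hfix.eq] at h
  rw [← h, add_mulVec, ← mulVec_mulVec]

theorem isStable_of_isFixedPt_riccati (hobs : IsObservable A Q) (hQ : Q.PosSemidef) (hR : R.PosDef)
    (hP : P.PosSemidef) (hfix : Function.IsFixedPt (riccati A B Q R) P) :
    IsStable (A + B * gainK A B R P) := by
  refine isStable_iff_isTopologicallyNilpotent.2 (tendsto_zero_iff_mulVec.2 fun ξ => ?_)
  have hnext (k : ℕ) : (A + B * gainK A B R P) ^ (k + 1) *ᵥ ξ =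
      (A + B * gainK A B R P) *ᵥ ((A + B * gainK A B R P) ^ k *ᵥ ξ) := by
    rw [pow_succ', mulVec_mulVec]
  refine hobs.tendsto_zero_of_stageCost (B := B) hQ hR
    (u := fun k => gainK A B R P *ᵥ ((A + B * gainK A B R P) ^ k *ᵥ ξ))
    (fun k => (hnext k).trans (by rw [add_mulVec, mulVec_mulVec _ B])) ?_
  exact tendsto_zero_of_telescoping (fun k => stageCost_nonneg hQ hR.posSemidef _ _)
    (fun k => quadratic_nonneg hP _)
    fun k => hnext k ▸ quadratic_eq_of_isFixedPt_riccati hR hP hfix _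

theorem posDef_of_isFixedPt_riccati (hobs : IsObservable A Q) (hQ : Q.PosSemidef) (hR : R.PosDef)
    (hP : P.PosSemidef) (hfix : Function.IsFixedPt (riccati A B Q R) P) : P.PosDef := by
  have hker {y : Fin n → ℝ} (hy : P *ᵥ y = 0) : Q *ᵥ y = 0 ∧ P *ᵥ (A *ᵥ y) = 0 := by
    have h := quadratic_eq_of_isFixedPt_riccati hR hP hfix y
    rw [hy, dotProduct_zero, eq_comm, add_eq_zero_iff_of_nonneg
      (stageCost_nonneg hQ hR.posSemidef _ _) (quadratic_nonneg hP _), stageCost,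
      add_eq_zero_iff_of_nonneg (quadratic_nonneg hQ _) (quadratic_nonneg hR.posSemidef _),
      quadratic_eq_zero_iff hQ, quadratic_eq_zero_iff hR.posSemidef, quadratic_eq_zero_iff hP] at h
    obtain ⟨⟨hQy, hRKy⟩, hPy⟩ := h
    have hKy : gainK A B R P *ᵥ y = 0 :=
      mulVec_injective_of_isUnit hR.isUnit (hRKy.trans (mulVec_zero R).symm)
    rw [add_mulVec, ← mulVec_mulVec, hKy, mulVec_zero, add_zero] at hPy
    exact ⟨hQy, hPy⟩
  rw [hP.posDef_iff_isUnit, ← mulVec_injective_iff_isUnit, ← coe_mulVecLin, ← LinearMap.ker_eq_bot]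
  refine ker_mulVecLin_eq_bot_iff.2 fun x hx => hobs x fun k => (hker ?_).1
  induction k with
  | zero => rwa [pow_zero, one_mulVec]
  | succ k ih =>
    rw [pow_succ', ← mulVec_mulVec]
    exact (hker ih).2

theorem eq_of_isFixedPt_riccati (hobs : IsObservable A Q) (hQ : Q.PosSemidef) (hR : R.PosDef)
    (hP : P.PosSemidef) (hfix : Function.IsFixedPt (riccati A B Q R) P)
    (hP' : P'.PosSemidef) (hfix' : Function.IsFixedPt (riccati A B Q R) P') : P = P' := by
  have hM := isStable_iff_isTopologicallyNilpotent.1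
    (isStable_of_isFixedPt_riccati hobs hQ hR hP hfix)
  have hM' := isStable_iff_isTopologicallyNilpotent.1
    (isStable_of_isFixedPt_riccati hobs hQ hR hP' hfix')
  refine (existsUnique_stein hM' hM (Q + (gainK A B R P')ᵀ * R * gainK A B R P)).unique ?_ ?_
  · rw [add_comm, ← riccati_eq_of_gain hR hP, hfix.eq]
  · have h := congrArg transpose
      (riccati_eq_of_gain (A := A) (B := B) (Q := Q) hR hP' (gainK A B R P))
    rw [hfix'.eq] at h
    simpa only [transpose_add, transpose_mul, transpose_transpose, transpose_eq_of_posSemidef hP',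
      transpose_eq_of_posSemidef hQ, transpose_eq_of_posSemidef hR.posSemidef, Matrix.mul_assoc,
      add_comm] using h

end Riccati

section CoupledEquations

variable {n m : ℕ} {A : Matrix (Fin n) (Fin n) ℝ} {B : Matrix (Fin n) (Fin m) ℝ}
  {Fbar : Matrix (Fin m) (Fin n) ℝ} {Q : Matrix (Fin n) (Fin n) ℝ} {R : Matrix (Fin m) (Fin m) ℝ}
  {P Pbar : Matrix (Fin n) (Fin n) ℝ}

theorem transpose_gainKbar_mul_mul (hR : R.PosDef) (hP : P.PosSemidef) :
    (gainKbar A B Fbar R P)ᵀ * (R + Bᵀ * P * B) * gainKbar A B Fbar R P =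
      Fbarᵀ * (R + Bᵀ * P * B) * Fbar + Aᵀ * P * B * (R + Bᵀ * P * B)⁻¹ * Bᵀ * P * A
        + Aᵀ * P * B * Fbar + Fbarᵀ * Bᵀ * P * A := by
  have hSK := mul_gainK (A := A) (B := B) hR hP
  have hKS := transpose_gainK_mul (A := A) (B := B) hR hP
  have hcorr : Aᵀ * P * B * (R + Bᵀ * P * B)⁻¹ * Bᵀ * P * A = -(Aᵀ * P * B * gainK A B R P) := by
    simp only [gainK, Matrix.mul_neg, neg_neg, Matrix.mul_assoc]
  rw [gainKbar, transpose_sub, Matrix.sub_mul, hKS, Matrix.mul_sub, Matrix.sub_mul,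
    Matrix.sub_mul, Matrix.mul_assoc Fbarᵀ _ (gainK A B R P), hSK, hcorr]
  simp only [Matrix.mul_neg, Matrix.neg_mul, Matrix.mul_assoc]
  abel

theorem isPosDefSolution_iff (hR : R.PosDef) :
    IsPosDefSolution A B Fbar Q R P Pbar ↔
      P.PosDef ∧ Pbar.PosSemidef ∧ Function.IsFixedPt (riccati A B Q R) P ∧
        Pbar = (A + B * Fbar)ᵀ * Pbar * (A + B * Fbar) +
          (gainKbar A B Fbar R P)ᵀ * (R + Bᵀ * P * B) * gainKbar A B Fbar R P := by
  have hfix : Function.IsFixedPt (riccati A B Q R) P ↔ P = riccati A B Q R P := eq_comm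
  rw [IsPosDefSolution, SolvesARE, add_sub_cancel_left, hfix, riccati]
  refine ⟨fun ⟨⟨h, hbar⟩, hP, hPbar⟩ => ⟨hP, hPbar, h, ?_⟩,
    fun ⟨hP, hPbar, h, hbar⟩ => ⟨⟨h, ?_⟩, hP, hPbar⟩⟩
  all_goals simpa only [transpose_gainKbar_mul_mul hR hP.posSemidef, add_assoc] using hbar

theorem existsUnique_isPosDefSolution (hobs : IsObservable A Q) (hQ : Q.PosSemidef)
    (hR : R.PosDef) (hF : IsStable (A + B * Fbar)) :
    ∃! X : Matrix (Fin n) (Fin n) ℝ × Matrix (Fin n) (Fin n) ℝ,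
      IsPosDefSolution A B Fbar Q R X.1 X.2 := by
  obtain ⟨P, hP, hfix⟩ := exists_isFixedPt_riccati hQ hR hF
  have hF' := isStable_iff_isTopologicallyNilpotent.1 hF
  obtain ⟨Pbar, hPbar, huniq⟩ := existsUnique_stein hF' hF'
    ((gainKbar A B Fbar R P)ᵀ * (R + Bᵀ * P * B) * gainKbar A B Fbar R P)
  have hW := posSemidef_transpose_mul_mul (posDef_add_transpose_mul_mul (B := B) hR hP).posSemidef
    (gainKbar A B Fbar R P)
  refine ⟨(P, Pbar), (isPosDefSolution_iff hR).2 ⟨posDef_of_isFixedPt_riccati hobs hQ hR hP hfix,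
    posSemidef_of_stein hF' hW hPbar, hfix, hPbar⟩, ?_⟩
  rintro ⟨P', Pbar'⟩ h
  obtain ⟨hP', -, hfix', hPbar'⟩ := (isPosDefSolution_iff hR).1 h
  obtain rfl := eq_of_isFixedPt_riccati hobs hQ hR hP hfix hP'.posSemidef hfix'
  exact Prod.ext rfl (huniq Pbar' hPbar')

end CoupledEquations

section Average

variable {v d e : ℕ} {μ : Fin v → ℝ}

theorem average_add (z w : Fin v → Fin d → ℝ) :
    average μ (fun i => z i + w i) = average μ z + average μ w := by
  simp only [average, smul_add, Finset.sum_add_distrib]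

theorem average_sub (z w : Fin v → Fin d → ℝ) :
    average μ (fun i => z i - w i) = average μ z - average μ w := by
  simp only [average, smul_sub, Finset.sum_sub_distrib]

theorem average_mulVec (M : Matrix (Fin e) (Fin d) ℝ) (z : Fin v → Fin d → ℝ) :
    average μ (fun i => M *ᵥ z i) = M *ᵥ average μ z := by
  simp only [average, ← mulVec_smul, mulVec_sum]

theorem average_weight_smul (hμ : ∑ j, μ j ^ 2 ≠ 0) (y : Fin d → ℝ) :
    average μ (fun i => (μ i / ∑ j, μ j ^ 2) • y) = y := by
  simp only [average, smul_smul, ← Finset.sum_smul, mul_div_assoc', ← sq, ← Finset.sum_div]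
  rw [div_self hμ, one_smul]

theorem tendsto_average_zero {α : Type*} {l : Filter α} {z : α → Fin v → Fin d → ℝ}
    (hz : ∀ i, Tendsto (fun k => z k i) l (𝓝 0)) : Tendsto (fun k => average μ (z k)) l (𝓝 0) := by
  simpa only [average, smul_zero, Finset.sum_const_zero] using
    tendsto_finsetSum Finset.univ fun i _ => (hz i).const_smul (μ i)

-- The excess in the Cauchy–Schwarz inequality `a' M a ≤ (∑ μ i ^ 2) ∑ w i' M w i`, `a = ∑ μ i w i`.
theorem sum_quadratic_sub_average {M : Matrix (Fin d) (Fin d) ℝ} (hM : Mᵀ = M)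
    (hμ : ∑ j, μ j ^ 2 ≠ 0) (w : Fin v → Fin d → ℝ) :
    ∑ i, (w i - (μ i / ∑ j, μ j ^ 2) • average μ w) ⬝ᵥ M *ᵥ
        (w i - (μ i / ∑ j, μ j ^ 2) • average μ w) =
      ∑ i, w i ⬝ᵥ M *ᵥ w i - (1 / ∑ j, μ j ^ 2) * (average μ w ⬝ᵥ M *ᵥ average μ w) := by
  set c := ∑ j, μ j ^ 2 with hc
  set a := average μ w
  have hterm (i : Fin v) : (w i - (μ i / c) • a) ⬝ᵥ M *ᵥ (w i - (μ i / c) • a) =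
      w i ⬝ᵥ M *ᵥ w i - 2 / c * (a ⬝ᵥ M *ᵥ (μ i • w i))
        + μ i ^ 2 * ((a ⬝ᵥ M *ᵥ a) / c ^ 2) := by
    rw [quadratic_sub hM]
    simp only [mulVec_smul, dotProduct_smul, smul_dotProduct, smul_eq_mul]
    ring
  simp only [hterm, Finset.sum_add_distrib, Finset.sum_sub_distrib, ← Finset.mul_sum,
    ← Finset.sum_mul, ← dotProduct_sum, ← mulVec_sum]
  rw [← hc, show ∑ i, μ i • w i = a from rfl]
  field_simp
  ring

end Average

section Distributed

variable {n m v : ℕ} {A : Matrix (Fin n) (Fin n) ℝ} {B : Matrix (Fin n) (Fin m) ℝ}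
  {Q : Matrix (Fin n) (Fin n) ℝ} {R : Matrix (Fin m) (Fin m) ℝ} {Fbar : Matrix (Fin m) (Fin n) ℝ}
  {P Pbar : Matrix (Fin n) (Fin n) ℝ} {μ : Fin v → ℝ} {ξ : Fin v → Fin n → ℝ}
  {x : ℕ → Fin v → Fin n → ℝ} {u : ℕ → Fin v → Fin m → ℝ}

theorem average_step {z : Fin v → Fin n → ℝ} {w : Fin v → Fin m → ℝ}
    (hw : average μ w = Fbar *ᵥ average μ z) :
    average μ (fun i => A *ᵥ z i + B *ᵥ w i) = (A + B * Fbar) *ᵥ average μ z := by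
  rw [average_add, average_mulVec, average_mulVec, hw, add_mulVec, mulVec_mulVec]

theorem IsTrajectory.succ_eq (hx : IsTrajectory A B ξ x u) (k : ℕ) :
    x (k + 1) = fun i => A *ᵥ x k i + B *ᵥ u k i :=
  funext (hx.2 k)

theorem IsTrajectory.average_eq (hx : IsTrajectory A B ξ x u) (hu : SatisfiesConstraint μ Fbar x u)
    (k : ℕ) : average μ (x k) = (A + B * Fbar) ^ k *ᵥ average μ ξ := by
  induction k with
  | zero => rw [hx.1, pow_zero, one_mulVec]
  | succ k ih => rw [hx.succ_eq, average_step (hu k), ih, pow_succ', mulVec_mulVec]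

theorem isTrajectory_closedLoop (L Lbar : Fin v → Matrix (Fin m) (Fin n) ℝ) :
    IsTrajectory A B ξ (closedLoopState A B μ L Lbar ξ) (closedLoopInput A B μ L Lbar ξ) :=
  ⟨rfl, fun _ _ => rfl⟩

theorem isStable_of_stabilizable (hμ : ∑ j, μ j ^ 2 ≠ 0) (h : Stabilizable A B μ Fbar) :
    IsStable (A + B * Fbar) := by
  obtain ⟨L, Lbar, hstab⟩ := h
  refine isStable_iff_isTopologicallyNilpotent.2 (tendsto_zero_iff_mulVec.2 fun y => ?_)
  obtain ⟨hconstraint, hlim⟩ := hstab fun i => (μ i / ∑ j, μ j ^ 2) • y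
  simpa only [(isTrajectory_closedLoop L Lbar).average_eq hconstraint, average_weight_smul hμ]
    using tendsto_average_zero (μ := μ) hlim

theorem sum_stageCost_nonneg (hQ : Q.PosSemidef) (hR : R.PosSemidef) (z : Fin v → Fin n → ℝ)
    (w : Fin v → Fin m → ℝ) : 0 ≤ ∑ i, stageCost Q R (z i) (w i) :=
  Finset.sum_nonneg fun _ _ => stageCost_nonneg hQ hR _ _

theorem cost_eq_tsum (hQ : Q.PosSemidef) (hR : R.PosSemidef) :
    cost Q R x u = ∑' k, ENNReal.ofReal (∑ i, stageCost Q R (x k i) (u k i)) := by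
  rw [cost, ← Summable.tsum_finsetSum fun _ _ => ENNReal.summable]
  refine tsum_congr fun k => Eq.symm ?_
  exact ENNReal.ofReal_sum_of_nonneg fun i _ => stageCost_nonneg hQ hR _ _

theorem IsTrajectory.tendsto_zero (hx : IsTrajectory A B ξ x u) (hobs : IsObservable A Q)
    (hQ : Q.PosSemidef) (hR : R.PosDef)
    (hcost : Tendsto (fun k => ∑ i, stageCost Q R (x k i) (u k i)) atTop (𝓝 0)) (i : Fin v) :
    Tendsto (fun k => x k i) atTop (𝓝 0) := by
  have hnonneg (k : ℕ) (j : Fin v) := stageCost_nonneg hQ hR.posSemidef (x k j) (u k j)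
  exact hobs.tendsto_zero_of_stageCost hQ hR (hx.2 · i) (squeeze_zero (hnonneg · i)
    (fun k => Finset.single_le_sum (fun j _ => hnonneg k j) (Finset.mem_univ i)) hcost)

theorem optimalValue_nonneg (hP : P.PosSemidef) (hPbar : Pbar.PosSemidef) (z : Fin v → Fin n → ℝ) :
    0 ≤ optimalValue μ P Pbar z := by
  have hsum : 0 ≤ ∑ i, z i ⬝ᵥ P *ᵥ z i := Finset.sum_nonneg fun i _ => quadratic_nonneg hP _
  have haverage := quadratic_nonneg hPbar (average μ z)
  unfold optimalValue
  positivity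

theorem tendsto_optimalValue_zero (hx : ∀ i, Tendsto (fun k => x k i) atTop (𝓝 0)) :
    Tendsto (fun k => optimalValue μ P Pbar (x k)) atTop (𝓝 0) := by
  have hsum := tendsto_finsetSum Finset.univ fun i _ => tendsto_quadratic_zero P (hx i)
  have haverage := (tendsto_quadratic_zero Pbar (tendsto_average_zero (μ := μ) hx)).const_mul
    (1 / ∑ j, μ j ^ 2)
  simpa only [optimalValue, Finset.sum_const_zero, mul_zero, add_zero] using hsum.add haverage

/-- The feedback `u i = K x i + (μ i / ∑ j, μ j ^ 2) Kbar xbar` with the gains obtained from `P`,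
optimal when `P` solves the Riccati equation. -/
noncomputable def optimalFeedback (A : Matrix (Fin n) (Fin n) ℝ) (B : Matrix (Fin n) (Fin m) ℝ)
    (μ : Fin v → ℝ) (Fbar : Matrix (Fin m) (Fin n) ℝ) (R : Matrix (Fin m) (Fin m) ℝ)
    (P : Matrix (Fin n) (Fin n) ℝ) : (Fin v → Fin n → ℝ) → Fin v → Fin m → ℝ :=
  feedback μ (fun _ => gainK A B R P) fun i => (μ i / ∑ j, μ j ^ 2) • gainKbar A B Fbar R P

theorem optimalFeedback_apply (z : Fin v → Fin n → ℝ) (i : Fin v) :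
    optimalFeedback A B μ Fbar R P z i = gainK A B R P *ᵥ z i +
      (μ i / ∑ j, μ j ^ 2) • (gainKbar A B Fbar R P *ᵥ average μ z) := by
  rw [optimalFeedback, feedback, smul_mulVec]

theorem average_optimalFeedback (hμ : ∑ j, μ j ^ 2 ≠ 0) (z : Fin v → Fin n → ℝ) :
    average μ (optimalFeedback A B μ Fbar R P z) = Fbar *ᵥ average μ z := by
  rw [funext (optimalFeedback_apply z), average_add, average_mulVec, average_weight_smul hμ,
    gainKbar, sub_mulVec, add_sub_cancel]

-- `w - K z` has average `Kbar zbar`, so the optimal feedback subtracts from it its projection in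
-- `sum_quadratic_sub_average`; the quadratic form in `Kbar zbar` left over is paid for by `Pbar`.
theorem optimalValue_step (hμ : ∑ j, μ j ^ 2 ≠ 0) (hR : R.PosDef)
    (hsol : IsPosDefSolution A B Fbar Q R P Pbar) {z : Fin v → Fin n → ℝ} {w : Fin v → Fin m → ℝ}
    (hw : average μ w = Fbar *ᵥ average μ z) :
    optimalValue μ P Pbar z + ∑ i, (w i - optimalFeedback A B μ Fbar R P z i) ⬝ᵥ
        (R + Bᵀ * P * B) *ᵥ (w i - optimalFeedback A B μ Fbar R P z i) =
      ∑ i, stageCost Q R (z i) (w i) + optimalValue μ P Pbar (fun i => A *ᵥ z i + B *ᵥ w i) := by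
  obtain ⟨hP, -, hfix, hPbar⟩ := (isPosDefSolution_iff hR).1 hsol
  have hS := transpose_eq_of_posSemidef
    (posDef_add_transpose_mul_mul (B := B) hR hP.posSemidef).posSemidef
  have haverage : average μ (fun i => w i - gainK A B R P *ᵥ z i) =
      gainKbar A B Fbar R P *ᵥ average μ z := by
    rw [average_sub, average_mulVec, hw, gainKbar, sub_mulVec]
  have hdeviation := sum_quadratic_sub_average hS hμ fun i => w i - gainK A B R P *ᵥ z i
  rw [haverage] at hdeviation
  have hstep := Finset.sum_congr rfl fun i (_ : i ∈ Finset.univ) =>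
    stageCost_add_quadratic (A := A) (B := B) (Q := Q) hR hP.posSemidef (z i) (w i)
  simp only [hfix.eq, Finset.sum_add_distrib] at hstep
  have hPbar_step : average μ z ⬝ᵥ Pbar *ᵥ average μ z =
      ((A + B * Fbar) *ᵥ average μ z) ⬝ᵥ Pbar *ᵥ ((A + B * Fbar) *ᵥ average μ z) +
        (gainKbar A B Fbar R P *ᵥ average μ z) ⬝ᵥ (R + Bᵀ * P * B) *ᵥ
          (gainKbar A B Fbar R P *ᵥ average μ z) := by
    rw [← quadratic_transpose_mul_mul, ← quadratic_transpose_mul_mul, ← dotProduct_add,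
      ← add_mulVec, ← hPbar]
  simp only [optimalFeedback_apply, ← sub_sub, optimalValue, average_step hw]
  rw [hdeviation, hPbar_step]
  linear_combination -hstep

theorem ofReal_optimalValue_le_cost (hμ : ∑ j, μ j ^ 2 ≠ 0) (hobs : IsObservable A Q)
    (hQ : Q.PosSemidef) (hR : R.PosDef) (hsol : IsPosDefSolution A B Fbar Q R P Pbar)
    (hx : IsTrajectory A B ξ x u) (hu : SatisfiesConstraint μ Fbar x u) :
    ENNReal.ofReal (optimalValue μ P Pbar ξ) ≤ cost Q R x u := by
  obtain ⟨hP, -⟩ := (isPosDefSolution_iff hR).1 hsol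
  rw [cost_eq_tsum hQ hR.posSemidef, ← hx.1]
  refine ofReal_le_tsum_of_telescoping (V := fun k => optimalValue μ P Pbar (x k))
    (fun k => sum_stageCost_nonneg hQ hR.posSemidef _ _)
    (fun hsum => tendsto_optimalValue_zero (hx.tendsto_zero hobs hQ hR hsum.tendsto_atTop_zero))
    fun k => ?_
  rw [hx.succ_eq, ← optimalValue_step hμ hR hsol (hu k)]
  exact le_add_of_nonneg_right (Finset.sum_nonneg fun i _ =>
    quadratic_nonneg (posDef_add_transpose_mul_mul hR hP.posSemidef).posSemidef _)

theorem optimalValue_eq_of_optimalFeedback (hμ : ∑ j, μ j ^ 2 ≠ 0) (hR : R.PosDef)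
    (hsol : IsPosDefSolution A B Fbar Q R P Pbar) (hx : IsTrajectory A B ξ x u)
    (hu : ∀ k, u k = optimalFeedback A B μ Fbar R P (x k)) (k : ℕ) :
    optimalValue μ P Pbar (x k) =
      ∑ i, stageCost Q R (x k i) (u k i) + optimalValue μ P Pbar (x (k + 1)) := by
  have hstep := optimalValue_step hμ hR hsol ((hu k).symm ▸ average_optimalFeedback hμ (x k))
  simpa only [← hx.succ_eq, ← hu, sub_self, zero_dotProduct, Finset.sum_const_zero, add_zero]
    using hstep

theorem tendsto_zero_of_optimalFeedback (hμ : ∑ j, μ j ^ 2 ≠ 0) (hobs : IsObservable A Q)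
    (hQ : Q.PosSemidef) (hR : R.PosDef) (hsol : IsPosDefSolution A B Fbar Q R P Pbar)
    (hx : IsTrajectory A B ξ x u) (hu : ∀ k, u k = optimalFeedback A B μ Fbar R P (x k))
    (i : Fin v) : Tendsto (fun k => x k i) atTop (𝓝 0) := by
  obtain ⟨hP, hPbar, -⟩ := (isPosDefSolution_iff hR).1 hsol
  exact hx.tendsto_zero hobs hQ hR (tendsto_zero_of_telescoping
    (fun k => sum_stageCost_nonneg hQ hR.posSemidef _ _)
    (fun k => optimalValue_nonneg hP.posSemidef hPbar _)
    (optimalValue_eq_of_optimalFeedback hμ hR hsol hx hu)) i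

theorem cost_eq_of_optimalFeedback (hμ : ∑ j, μ j ^ 2 ≠ 0) (hobs : IsObservable A Q)
    (hQ : Q.PosSemidef) (hR : R.PosDef) (hsol : IsPosDefSolution A B Fbar Q R P Pbar)
    (hx : IsTrajectory A B ξ x u) (hu : ∀ k, u k = optimalFeedback A B μ Fbar R P (x k)) :
    cost Q R x u = ENNReal.ofReal (optimalValue μ P Pbar ξ) := by
  have hnonneg (k : ℕ) := sum_stageCost_nonneg hQ hR.posSemidef (x k) (u k)
  have hsum := hasSum_of_telescoping hnonneg
    (tendsto_optimalValue_zero (tendsto_zero_of_optimalFeedback hμ hobs hQ hR hsol hx hu))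
    (optimalValue_eq_of_optimalFeedback hμ hR hsol hx hu)
  rw [cost_eq_tsum hQ hR.posSemidef, ← ENNReal.ofReal_tsum_of_nonneg hnonneg hsum.summable,
    hsum.tsum_eq, hx.1]

theorem coe_ofReal_optimalValue (hR : R.PosDef) (hsol : IsPosDefSolution A B Fbar Q R P Pbar) :
    (ENNReal.ofReal (optimalValue μ P Pbar ξ) : EReal) = optimalValue μ P Pbar ξ := by
  obtain ⟨hP, hPbar, -⟩ := (isPosDefSolution_iff hR).1 hsol
  rw [EReal.coe_ennreal_ofReal, max_eq_left (optimalValue_nonneg hP.posSemidef hPbar ξ)]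

theorem stabilizes_optimalFeedback (hμ : ∑ j, μ j ^ 2 ≠ 0) (hobs : IsObservable A Q)
    (hQ : Q.PosSemidef) (hR : R.PosDef) (hsol : IsPosDefSolution A B Fbar Q R P Pbar) :
    Stabilizes A B μ Fbar (fun _ => gainK A B R P)
      (fun i => (μ i / ∑ j, μ j ^ 2) • gainKbar A B Fbar R P) := fun _ =>
  ⟨fun _ => average_optimalFeedback hμ _, tendsto_zero_of_optimalFeedback hμ hobs hQ hR hsol
    (isTrajectory_closedLoop _ _) fun _ => rfl⟩

end Distributed

end DistributedLQ

theorem theorem2 {n m v p : ℕ}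
    (A : Matrix (Fin n) (Fin n) ℝ) (B : Matrix (Fin n) (Fin m) ℝ)
    (Q : Matrix (Fin n) (Fin n) ℝ) (R : Matrix (Fin m) (Fin m) ℝ)
    (C : Matrix (Fin p) (Fin n) ℝ) (Fbar : Matrix (Fin m) (Fin n) ℝ)
    (μ : Fin v → ℝ) (hμ : ∑ j, μ j ^ 2 ≠ 0)
    (hQ : Q.PosSemidef) (hR : R.PosDef)
    (hCQ : Cᵀ * C = Q) (hobs : DistributedLQ.IsObservable A C) :
    List.TFAE
      [DistributedLQ.Stabilizable A B μ Fbar,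
       DistributedLQ.IsStable (A + B * Fbar),
       ∃! X : Matrix (Fin n) (Fin n) ℝ × Matrix (Fin n) (Fin n) ℝ,
         DistributedLQ.IsPosDefSolution A B Fbar Q R X.1 X.2] ∧
    ∀ P Pbar : Matrix (Fin n) (Fin n) ℝ,
      DistributedLQ.IsPosDefSolution A B Fbar Q R P Pbar →
      ∀ L Lbar : Fin v → Matrix (Fin m) (Fin n) ℝ,
        (L = fun _ => DistributedLQ.gainK A B R P) →
        (Lbar = fun i => (μ i / ∑ j, μ j ^ 2) • DistributedLQ.gainKbar A B Fbar R P) →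
        DistributedLQ.Stabilizes A B μ Fbar L Lbar ∧
        ∀ ξ : Fin v → Fin n → ℝ,
          (DistributedLQ.cost Q R (DistributedLQ.closedLoopState A B μ L Lbar ξ)
              (DistributedLQ.closedLoopInput A B μ L Lbar ξ) : EReal)
            = (DistributedLQ.optimalValue μ P Pbar ξ : EReal) ∧
          ∀ (x : ℕ → Fin v → Fin n → ℝ) (u : ℕ → Fin v → Fin m → ℝ),
            DistributedLQ.IsTrajectory A B ξ x u →
            DistributedLQ.SatisfiesConstraint μ Fbar x u →
            (DistributedLQ.optimalValue μ P Pbar ξ : EReal) ≤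
              (DistributedLQ.cost Q R x u : EReal) := by
  have hobsQ := hCQ ▸ hobs.transpose_mul_self
  open DistributedLQ in
  constructor
  · tfae_have 1 → 2 := isStable_of_stabilizable hμ
    tfae_have 2 → 3 := existsUnique_isPosDefSolution hobsQ hQ hR
    tfae_have 3 → 1 := fun ⟨_, hsol, _⟩ => ⟨_, _, stabilizes_optimalFeedback hμ hobsQ hQ hR hsol⟩
    tfae_finish
  · rintro P Pbar hsol _ _ rfl rfl
    refine ⟨stabilizes_optimalFeedback hμ hobsQ hQ hR hsol, fun ξ => ?_⟩
    rw [← coe_ofReal_optimalValue hR hsol]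
    refine ⟨?_, fun x u hx hu => ?_⟩
    · rw [cost_eq_of_optimalFeedback hμ hobsQ hQ hR hsol (isTrajectory_closedLoop _ _) fun _ => rfl]
    · exact EReal.coe_ennreal_le_coe_ennreal_iff.2
        (ofReal_optimalValue_le_cost hμ hobsQ hQ hR hsol hx hu)
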